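/- For natural numbers $k\le n$ let $\{0,1\}^n_k$ be the set of points of $\{0,1\}^n$ with exactly $k$ coordinates equal to $1$. A function $f:\{0,1\}^n_k\to\mathbb{R}$ is called a degree-$d$ function if it agrees on $\{0,1\}^n_k$ with a multilinear polynomial $\sum_{S\subseteq[n],\,|S|\le d}a_S\prod_{i\in S}x_i$ with real coefficients, and it is called an $r$-junta if there is a set $S\subseteq[n]$ with $|S|\le r$ such that $f(x)=f(y)$ for all $x,y\in\{0,1\}^n_k$ that agree on the coordinates in $S$. **Lemma.** There are absolute constants $C>0$ and $K\in\mathbb{N}$ such that, for every $d\in\mathbb{N}$ and every even $n\in\mathbb{N}$ with $d\le C\log n$ (where $\log 0$ is read as $0$), every Boolean-valued (that is, $\{0,1\}$-valued) degree-$d$ function $f:\{0,1\}^n_{n/2}\to\mathbb{R}$ is a $(K\,d\,2^d)$-junta. In particular, $f$ is an $\mathcal{O}(d\cdot 2^d)$-junta. -/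

import Mathlib

/-- The Boolean slice `{0,1}^n_k`: the points of the Boolean cube of Hamming weight exactly `k`. -/
abbrev BooleanSlice (n k : ℕ) : Type :=
  {x : Fin n → Bool // (Finset.univ.filter fun i => x i = true).card = k}

/-- The coordinates of a point of the slice, as the real numbers `0` and `1`. -/
def BooleanSlice.toReal {n k : ℕ} (x : BooleanSlice n k) : Fin n → ℝ :=
  fun i => if x.1 i = true then 1 else 0

/-- `f` is a degree-`d` function on the slice `{0,1}^n_k`: it can be expressed there as a
multilinear polynomial (degree at most one in each variable) with real coefficients and of total
degree at most `d`. -/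
def IsSliceDegree {n k : ℕ} (d : ℕ) (f : BooleanSlice n k → ℝ) : Prop :=
  ∃ P : MvPolynomial (Fin n) ℝ, P ∈ MvPolynomial.restrictDegree (Fin n) ℝ 1 ∧
    P.totalDegree ≤ d ∧ ∀ x : BooleanSlice n k, f x = MvPolynomial.eval x.toReal P

/-- `f` takes only the values `0` and `1`. -/
def IsBooleanValued {n k : ℕ} (f : BooleanSlice n k → ℝ) : Prop :=
  ∀ x : BooleanSlice n k, f x = 0 ∨ f x = 1

/-- `f` is an `r`-junta on the slice: there is a set `S` of at most `r` coordinates such that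
`f x` is determined by the coordinates of `x` in `S`. -/
def IsSliceJunta {n k : ℕ} (r : ℕ) (f : BooleanSlice n k → ℝ) : Prop :=
  ∃ S : Finset (Fin n), S.card ≤ r ∧
    ∀ x y : BooleanSlice n k, (∀ i ∈ S, x.1 i = y.1 i) → f x = f y

/-! Write `n = 2m` and extend `f` to a function `G` of degree at most `d` on the whole cube. The
plan is to find a large set of mutually interchangeable coordinates, and then to reduce the problem
to an honest cube, where the Nisan–Szegedy bound `card_relevant_le` applies.

Two estimates are played against each other. By a Schwartz–Zippel bound for the middle slice
(`centralBinom_le_card_support`), a transposition that changes `G` somewhere on the slice changes it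
on at least a `4 ^ -(d + 1)` fraction of points. At a single point, disjoint sensitive pairs span an
embedded cube, so Nisan–Szegedy allows at most `d * 2 ^ d` of them; a maximal matching then shows
that `O(d * 2 ^ d * m)` pairs are sensitive there (`card_sensitivePairs_le`). Double counting leaves
fewer than `2 * m ^ 2` non-exchangeable ordered pairs once `m` is exponentially large in `d`, which
is where `d ≤ C log n` enters.

Exchangeability is an equivalence relation, so some class has at least `m` elements and `f` depends
only on a set `S` of at most `m` coordinates (`exists_half_junta`). There is then room to pair each
element of `S` with a private one outside, which embeds the full cube on `S` into the slice; a
second use of Nisan–Szegedy finishes. -/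

/-- The `0/1`-valued coordinate `v` on the cube, whose points are the subsets of `V`. -/
noncomputable def setCoord {V : Type*} [DecidableEq V] (v : V) : Finset V → ℝ :=
  fun x => if v ∈ x then 1 else 0

/-- The affine functions on the cube of subsets of `V`; the power `affineFun V ^ d` consists of
the functions of degree at most `d`. -/
noncomputable def affineFun (V : Type*) [DecidableEq V] : Submodule ℝ (Finset V → ℝ) :=
  Submodule.span ℝ (insert 1 (Set.range setCoord))

/-- Precomposition with a map, as a homomorphism of function algebras. -/
noncomputable def precomp {X Y : Type*} (φ : X → Y) : (Y → ℝ) →ₐ[ℝ] (X → ℝ) :=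
  AlgHom.ofLinearMap (LinearMap.funLeft ℝ ℝ φ) rfl (fun _ _ => rfl)

lemma const_mem_one {V : Type*} (c : ℝ) : (fun _ => c : Finset V → ℝ) ∈ (1 : Submodule ℝ (Finset V → ℝ)) := by
  rw [Submodule.mem_one]
  exact ⟨c, rfl⟩

/-! ### Degree filtration and discrete derivatives -/

section Degree

variable {V ι : Type*} [DecidableEq V] [DecidableEq ι]

lemma one_mem_affineFun : (1 : Finset V → ℝ) ∈ affineFun V :=
  Submodule.subset_span (Set.mem_insert _ _)

lemma setCoord_mem_affineFun (v : V) : setCoord v ∈ affineFun V :=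
  Submodule.subset_span (Set.mem_insert_of_mem _ ⟨v, rfl⟩)

lemma one_le_affineFun : 1 ≤ affineFun V := Submodule.one_le.2 one_mem_affineFun

lemma affineFun_pow_mono {d e : ℕ} (h : d ≤ e) : affineFun V ^ d ≤ affineFun V ^ e := by
  induction h with
  | refl => exact le_rfl
  | step _ ih =>
    refine ih.trans ?_
    rw [Nat.succ_eq_add_one, pow_succ]
    calc _ = affineFun V ^ _ * 1 := (mul_one _).symm
      _ ≤ _ := mul_le_mul' le_rfl one_le_affineFun

lemma const_mem_affineFun_pow (c : ℝ) (d : ℕ) : (fun _ => c : Finset V → ℝ) ∈ affineFun V ^ d :=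
  affineFun_pow_mono (Nat.zero_le d) (by rw [pow_zero]; exact const_mem_one c)

lemma const_mem_affineFun (c : ℝ) : (fun _ => c : Finset V → ℝ) ∈ affineFun V := by
  simpa using const_mem_affineFun_pow (V := V) c 1

lemma precomp_mem_affineFun {φ : Finset ι → Finset V}
    (hφ : ∀ v, setCoord v ∘ φ ∈ affineFun ι) {G : Finset V → ℝ} (hG : G ∈ affineFun V) :
    precomp φ G ∈ affineFun ι := by
  have : affineFun V ≤ (affineFun ι).comap (precomp φ).toLinearMap := by
    refine Submodule.span_le.2 ?_
    rintro _ (rfl | ⟨v, rfl⟩)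
    · exact one_mem_affineFun
    · exact hφ v
  exact this hG

lemma precomp_mem_affineFun_pow {φ : Finset ι → Finset V}
    (hφ : ∀ v, setCoord v ∘ φ ∈ affineFun ι) {d : ℕ} {G : Finset V → ℝ}
    (hG : G ∈ affineFun V ^ d) : precomp φ G ∈ affineFun ι ^ d := by
  have h1 : (affineFun V).map (precomp φ).toLinearMap ≤ affineFun ι := by
    rintro _ ⟨G, hG, rfl⟩
    exact precomp_mem_affineFun hφ hG
  have h2 := Submodule.mem_map_of_mem (f := (precomp φ).toLinearMap) hG
  rw [Submodule.map_pow] at h2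
  exact pow_le_pow_left' h1 d h2

/-- Leibniz rule: `φ(mn) - ψ(mn) = φ(m)(φ(n) - ψ(n)) + (φ(m) - ψ(m))ψ(n)`. Two affine substitutions
that differ by constants thus give a derivative lowering the degree by one; flips and transpositions
are the instances needed. -/
lemma precomp_sub_precomp_mem {φ ψ : Finset ι → Finset V}
    (hφ : ∀ v, setCoord v ∘ φ ∈ affineFun ι) (hψ : ∀ v, setCoord v ∘ ψ ∈ affineFun ι)
    (hδ : ∀ v, setCoord v ∘ φ - setCoord v ∘ ψ ∈ (1 : Submodule ℝ (Finset ι → ℝ)))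
    {d : ℕ} {G : Finset V → ℝ} (hG : G ∈ affineFun V ^ (d + 1)) :
    precomp φ G - precomp ψ G ∈ affineFun ι ^ d := by
  have base : ∀ G ∈ affineFun V, precomp φ G - precomp ψ G ∈ (1 : Submodule ℝ (Finset ι → ℝ)) := by
    have : affineFun V ≤ (1 : Submodule ℝ (Finset ι → ℝ)).comap
        ((precomp φ).toLinearMap - (precomp ψ).toLinearMap) := by
      refine Submodule.span_le.2 ?_
      rintro _ (rfl | ⟨v, rfl⟩)
      · simp
      · exact hδ v
    exact fun G hG => this hG
  induction d generalizing G with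
  | zero =>
    rw [pow_zero]
    exact base G (by simpa using hG)
  | succ d ih =>
    have : affineFun V ^ (d + 1 + 1) ≤ (affineFun ι ^ (d + 1)).comap
        ((precomp φ).toLinearMap - (precomp ψ).toLinearMap) := by
      rw [pow_succ' _ (d + 1), Submodule.mul_le]
      intro m hm n hn
      have e : ((precomp φ).toLinearMap - (precomp ψ).toLinearMap) (m * n) =
          precomp φ m * (precomp φ n - precomp ψ n) + (precomp φ m - precomp ψ m) * precomp ψ n := by
        simp only [LinearMap.sub_apply, AlgHom.toLinearMap_apply, map_mul]
        ring
      rw [Submodule.mem_comap, e]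
      refine Submodule.add_mem _ ?_ ?_
      · rw [pow_succ']
        exact Submodule.mul_mem_mul (precomp_mem_affineFun hφ hm) (ih hn)
      · have := Submodule.mul_mem_mul (base m hm) (precomp_mem_affineFun_pow hψ hn)
        rwa [one_mul] at this
    exact this hG

lemma eval_setCoord_mem_affineFun_pow {d : ℕ} (P : MvPolynomial V ℝ) (hP : P.totalDegree ≤ d) :
    (fun x : Finset V => MvPolynomial.eval (fun v => setCoord v x) P) ∈ affineFun V ^ d := by
  have e : (fun x : Finset V => MvPolynomial.eval (fun v => setCoord v x) P) =
      ∑ s ∈ P.support, P.coeff s • ∏ v ∈ s.support, setCoord v ^ s v := by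
    ext x
    simp [MvPolynomial.eval_eq]
  rw [e]
  refine Submodule.sum_mem _ fun s hs => Submodule.smul_mem _ _ ?_
  have h : ∀ t : Finset V, ∏ v ∈ t, setCoord v ^ s v ∈ affineFun V ^ ∑ v ∈ t, s v := by
    intro t
    induction t using Finset.induction_on with
    | empty => simp
    | insert a t ha ih =>
      rw [Finset.prod_insert ha, Finset.sum_insert ha, pow_add]
      exact Submodule.mul_mem_mul (Submodule.pow_mem_pow _ (setCoord_mem_affineFun a) _) ih
  exact affineFun_pow_mono ((MvPolynomial.le_totalDegree hs).trans hP) (h s.support)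

lemma setCoord_insert_erase (a b v : V) (hab : a ≠ b) :
    setCoord v ∘ (fun x => insert a (x.erase b)) =
      if v = a then fun _ => 1 else if v = b then fun _ => 0 else setCoord v := by
  ext x
  simp only [setCoord, Function.comp]
  split_ifs <;> simp_all [setCoord]

/-- The difference of a function of degree at most `d + 1` along a transposition has degree at
most `d`. -/
lemma swap_difference_mem {a b : V} (hab : a ≠ b) {d : ℕ} {G : Finset V → ℝ}
    (hG : G ∈ affineFun V ^ (d + 1)) :
    (fun x => G (insert a (x.erase b)) - G (insert b (x.erase a))) ∈ affineFun V ^ d := by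
  refine precomp_sub_precomp_mem (φ := fun x => insert a (x.erase b))
    (ψ := fun x => insert b (x.erase a)) (fun v => ?_) (fun v => ?_) (fun v => ?_) hG
  · rw [setCoord_insert_erase a b v hab]
    split_ifs
    exacts [const_mem_affineFun _, const_mem_affineFun _, setCoord_mem_affineFun v]
  · rw [setCoord_insert_erase b a v hab.symm]
    split_ifs
    exacts [const_mem_affineFun _, const_mem_affineFun _, setCoord_mem_affineFun v]
  · rw [setCoord_insert_erase a b v hab, setCoord_insert_erase b a v hab.symm]
    split_ifs
    · simp_all
    · exact Submodule.sub_mem _ (const_mem_one _) (const_mem_one _)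
    · exact Submodule.sub_mem _ (const_mem_one _) (const_mem_one _)
    · simp

/-- The difference of a function of degree at most `d + 1` along a coordinate has degree at
most `d`. -/
lemma flip_difference_mem (a : V) {d : ℕ} {G : Finset V → ℝ} (hG : G ∈ affineFun V ^ (d + 1)) :
    (fun x => G (insert a x) - G (x.erase a)) ∈ affineFun V ^ d := by
  have h1 (v : V) : setCoord v ∘ (fun x => insert a x) =
      if v = a then fun _ => 1 else setCoord v := by
    ext x; simp only [setCoord, Function.comp]; split_ifs <;> simp_all [setCoord]
  have h0 (v : V) : setCoord v ∘ (fun x => x.erase a) =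
      if v = a then fun _ => 0 else setCoord v := by
    ext x; simp only [setCoord, Function.comp]; split_ifs <;> simp_all [setCoord]
  refine precomp_sub_precomp_mem (φ := fun x => insert a x)
    (ψ := fun x => x.erase a) (fun v => ?_) (fun v => ?_) (fun v => ?_) hG
  · rw [h1]
    split_ifs
    exacts [const_mem_affineFun _, setCoord_mem_affineFun v]
  · rw [h0]
    split_ifs
    exacts [const_mem_affineFun _, setCoord_mem_affineFun v]
  · rw [h1, h0]
    split_ifs
    · exact Submodule.sub_mem _ (const_mem_one _) (const_mem_one _)
    · simp

lemma exists_const_of_mem_affineFun_pow_zero {G : Finset V → ℝ} (hG : G ∈ affineFun V ^ 0) :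
    ∃ c, ∀ x, G x = c := by
  rw [pow_zero, Submodule.mem_one] at hG
  obtain ⟨c, rfl⟩ := hG
  exact ⟨c, fun _ => rfl⟩

end Degree

/-! ### Schwartz–Zippel bounds on the cube and the middle slice -/

section SchwartzZippel

variable {V : Type*} [DecidableEq V]

lemma two_pow_card_le_card_support_of_const {V : Type*} {d : ℕ} {T : Finset V}
    {G : Finset V → ℝ} (h : ∃ x ⊆ T, G x ≠ 0) (hc : ∀ x ⊆ T, ∀ y ⊆ T, G x = G y) :
    2 ^ T.card ≤ 2 ^ d * (T.powerset.filter fun x => G x ≠ 0).card := by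
  obtain ⟨x, hx, hGx⟩ := h
  rw [Finset.filter_true_of_mem (fun y hy => by rwa [hc y (Finset.mem_powerset.1 hy) x hx]),
    Finset.card_powerset]
  exact Nat.le_mul_of_pos_left _ (by positivity)

/-- If no flip matters, `G` is constant on the cube. Otherwise some derivative is nonzero on a
subcube of half the size, and each point of its support yields a point of the support of `G`; each
degree costs a factor 2. -/
lemma two_pow_card_le_card_support (d : ℕ) (T : Finset V) (G : Finset V → ℝ)
    (hG : G ∈ affineFun V ^ d) (h : ∃ x ⊆ T, G x ≠ 0) :
    2 ^ T.card ≤ 2 ^ d * (T.powerset.filter fun x => G x ≠ 0).card := by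
  induction d generalizing T G with
  | zero =>
    obtain ⟨c, hc⟩ := exists_const_of_mem_affineFun_pow_zero hG
    exact two_pow_card_le_card_support_of_const h fun x _ y _ => by rw [hc, hc]
  | succ d ih =>
    by_cases hinv : ∀ a ∈ T, ∀ x ⊆ T, G (insert a x) = G (x.erase a)
    · have hc : ∀ x ⊆ T, G x = G ∅ := by
        intro x hx
        induction x using Finset.induction_on with
        | empty => rfl
        | insert a s ha ih' =>
          rw [hinv a (hx (Finset.mem_insert_self _ _)) s ((Finset.subset_insert _ _).trans hx),
            Finset.erase_eq_of_notMem ha]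
          exact ih' ((Finset.subset_insert _ _).trans hx)
      exact two_pow_card_le_card_support_of_const h fun x hx y hy => by rw [hc x hx, hc y hy]
    · push Not at hinv
      obtain ⟨a, ha, x, hx, hne⟩ := hinv
      have key : 2 ^ (T.erase a).card ≤ 2 ^ d * ((T.erase a).powerset.filter
          fun x => G (insert a x) - G (x.erase a) ≠ 0).card := by
        refine ih _ _ (flip_difference_mem a hG)
          ⟨x.erase a, Finset.erase_subset_erase _ hx, sub_ne_zero.2 ?_⟩
        have e : insert a (x.erase a) = insert a x := by
          ext v
          by_cases hv : v = a <;> simp [hv]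
        rwa [Finset.erase_idem, e]
      have hcard : ((T.erase a).powerset.filter
          fun x => G (insert a x) - G (x.erase a) ≠ 0).card ≤
          (T.powerset.filter fun x => G x ≠ 0).card := by
        refine Finset.card_le_card_of_injOn
          (fun x => if G x ≠ 0 then x else insert a x) ?_ ?_
        · intro y hy
          simp only [Finset.coe_filter, Finset.mem_powerset, Set.mem_ofPred_eq] at hy ⊢
          have hay : a ∉ y := fun h => Finset.notMem_erase a T (hy.1 h)
          have hyT : y ⊆ T := hy.1.trans (Finset.erase_subset _ _)
          rw [Finset.erase_eq_of_notMem hay] at hy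
          split_ifs with h0
          · exact ⟨hyT, h0⟩
          · refine ⟨Finset.insert_subset ha hyT, fun h1 => hy.2 ?_⟩
            push Not at h0
            rw [h1, h0, sub_zero]
        · intro y hy z hz hyz
          simp only [Finset.coe_filter, Finset.mem_powerset, Set.mem_ofPred_eq] at hy hz
          have hay : a ∉ y := fun h => Finset.notMem_erase a T (hy.1 h)
          have haz : a ∉ z := fun h => Finset.notMem_erase a T (hz.1 h)
          have h1 := congrArg (fun s => s.erase a) hyz
          simp only at h1
          split_ifs at h1 <;>
            simpa [Finset.erase_insert hay, Finset.erase_insert haz,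
              Finset.erase_eq_of_notMem hay, Finset.erase_eq_of_notMem haz] using h1
      have hT : T.card = (T.erase a).card + 1 := (Finset.card_erase_add_one ha).symm
      rw [hT, pow_succ, pow_succ]
      nlinarith [Nat.mul_le_mul_left (2 ^ d) hcard]

lemma centralBinom_succ_le (m : ℕ) : (m + 1).centralBinom ≤ 4 * m.centralBinom := by
  have h := Nat.succ_mul_centralBinom_succ m
  refine Nat.le_of_mul_le_mul_left (c := m + 1) ?_ (Nat.succ_pos m)
  rw [h]
  nlinarith [Nat.zero_le m.centralBinom]

/-- A function on the sets of size `m` that is invariant under exchanges of an element is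
constant. -/
lemma eq_of_exchange_invariant {α : Type*} {A : Finset V} {m : ℕ} {G : Finset V → α}
    (hinv : ∀ a ∈ A, ∀ b ∈ A, ∀ x, x.card = m → a ∈ x → b ∉ x → G x = G (insert b (x.erase a)))
    (x y : Finset V) (hx : x.card = m) (hy : y.card = m) (hxy : x \ y ⊆ A) (hyx : y \ x ⊆ A) :
    G x = G y := by
  induction hk : (x \ y).card generalizing x with
  | zero =>
    have : x ⊆ y := by
      rwa [Finset.card_eq_zero, Finset.sdiff_eq_empty_iff_subset] at hk
    rw [Finset.eq_of_subset_of_card_le this (by omega)]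
  | succ k ih =>
    obtain ⟨a, ha⟩ : (x \ y).Nonempty := Finset.card_pos.1 (by omega)
    have hcard : (y \ x).card = (x \ y).card := by
      have h1 := Finset.card_sdiff_add_card_inter x y
      have h2 := Finset.card_sdiff_add_card_inter y x
      rw [Finset.inter_comm] at h2
      omega
    obtain ⟨b, hb⟩ : (y \ x).Nonempty := Finset.card_pos.1 (by omega)
    have haA := hxy ha
    have hbA := hyx hb
    rw [Finset.mem_sdiff] at ha hb
    have hbx : b ∉ x.erase a := fun h => hb.2 (Finset.mem_of_mem_erase h)
    have hab : b ≠ a := fun h => hb.2 (h ▸ ha.1)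
    have e : insert b (x.erase a) \ y = (x \ y).erase a := by
      ext v
      simp only [Finset.mem_sdiff, Finset.mem_insert, Finset.mem_erase]
      constructor
      · rintro ⟨rfl | h, h'⟩
        · exact absurd hb.1 h'
        · exact ⟨h.1, h.2, h'⟩
      · rintro ⟨h1, h2, h3⟩
        exact ⟨Or.inr ⟨h1, h2⟩, h3⟩
    rw [hinv a haA b hbA x hx ha.1 hb.2]
    refine ih _ ?_ ?_ ?_ ?_
    · rw [Finset.card_insert_of_notMem hbx, Finset.card_erase_add_one ha.1, hx]
    · rw [e]
      exact (Finset.erase_subset _ _).trans hxy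
    · intro v hv
      simp only [Finset.mem_sdiff, Finset.mem_insert, Finset.mem_erase, not_or, not_and] at hv
      by_cases hva : v = a
      · rw [hva]; exact haA
      · exact hyx (Finset.mem_sdiff.2 ⟨hv.1, hv.2.2 hva⟩)
    · rw [e, Finset.card_erase_of_mem (Finset.mem_sdiff.2 ha), hk, Nat.add_sub_cancel]

lemma centralBinom_le_card_support_of_const {V : Type*} {m d : ℕ} {T : Finset V} {G : Finset V → ℝ}
    (hT : T.card = 2 * m) (h : ∃ x ∈ T.powersetCard m, G x ≠ 0)
    (hc : ∀ x ∈ T.powersetCard m, ∀ y ∈ T.powersetCard m, G x = G y) :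
    m.centralBinom ≤ 4 ^ d * ((T.powersetCard m).filter fun x => G x ≠ 0).card := by
  obtain ⟨x, hx, hGx⟩ := h
  rw [Finset.filter_true_of_mem (fun y hy => by rwa [hc y hy x hx]), Finset.card_powersetCard,
    hT, ← Nat.centralBinom_eq_two_mul_choose]
  exact Nat.le_mul_of_pos_left _ (by positivity)

/-- The cube argument with transpositions in place of flips. Removing `a` and `b` passes to the
middle slice of a set with two fewer elements, and `centralBinom_succ_le` makes the cost 4 per
degree. -/
lemma centralBinom_le_card_support (d m : ℕ) (T : Finset V) (hT : T.card = 2 * m)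
    (G : Finset V → ℝ) (hG : G ∈ affineFun V ^ d) (h : ∃ x ∈ T.powersetCard m, G x ≠ 0) :
    m.centralBinom ≤ 4 ^ d * ((T.powersetCard m).filter fun x => G x ≠ 0).card := by
  induction d generalizing T G m with
  | zero =>
    obtain ⟨c, hc⟩ := exists_const_of_mem_affineFun_pow_zero hG
    exact centralBinom_le_card_support_of_const hT h fun x _ y _ => by rw [hc, hc]
  | succ d ih =>
    by_cases hinv : ∀ a ∈ T, ∀ b ∈ T, ∀ x ∈ T.powersetCard m, a ∈ x → b ∉ x →
        G x = G (insert b (x.erase a))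
    · refine centralBinom_le_card_support_of_const hT h fun x hx y hy => ?_
      rw [Finset.mem_powersetCard] at hx hy
      -- The exchange lemma quantifies over all `m`-sets of `V`, so `G` is replaced by zero off the
      -- subsets of `T`; exchanges inside `T` respect this.
      have := eq_of_exchange_invariant (A := T) (m := m)
        (G := fun z => if z ⊆ T then G z else 0) ?_ x y hx.2 hy.2
        (Finset.sdiff_subset.trans hx.1) (Finset.sdiff_subset.trans hy.1)
      · simpa [hx.1, hy.1] using this
      · intro a ha b hb z hz haz hbz
        by_cases hzT : z ⊆ T
        · have h2 : insert b (z.erase a) ⊆ T :=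
            Finset.insert_subset hb ((Finset.erase_subset _ _).trans hzT)
          simp only [hzT, h2, if_true]
          exact hinv a ha b hb z (Finset.mem_powersetCard.2 ⟨hzT, hz⟩) haz hbz
        · have h2 : ¬ insert b (z.erase a) ⊆ T := by
            intro h2
            refine hzT fun v hv => ?_
            by_cases hva : v = a
            · rwa [hva]
            · exact h2 (Finset.mem_insert_of_mem (Finset.mem_erase.2 ⟨hva, hv⟩))
          simp only [hzT, h2, if_false]
    · push Not at hinv
      obtain ⟨a, ha, b, hb, x, hx, hax, hbx, hne⟩ := hinv
      rw [Finset.mem_powersetCard] at hx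
      have hab : a ≠ b := fun h => hbx (h ▸ hax)
      obtain ⟨m, rfl⟩ : ∃ k, m = k + 1 := ⟨m - 1, by
        have := Finset.card_pos.2 ⟨a, hax⟩
        omega⟩
      have hbT : b ∈ T.erase a := Finset.mem_erase.2 ⟨hab.symm, hb⟩
      have hcT : ((T.erase a).erase b).card = 2 * m := by
        rw [Finset.card_erase_of_mem hbT, Finset.card_erase_of_mem ha, hT]
        omega
      have hxb : (x.erase a).erase b = x.erase a :=
        Finset.erase_eq_of_notMem fun h => hbx (Finset.mem_of_mem_erase h)
      have key := ih m _ hcT _ (swap_difference_mem hab hG) ⟨x.erase a, by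
        rw [Finset.mem_powersetCard, Finset.card_erase_of_mem hax, hx.2]
        refine ⟨fun v hv => ?_, rfl⟩
        have h1 := Finset.mem_erase.1 hv
        exact Finset.mem_erase.2 ⟨fun h => hbx (h ▸ h1.2), Finset.mem_erase.2 ⟨h1.1, hx.1 h1.2⟩⟩, by
        rw [hxb, Finset.erase_idem, Finset.insert_erase hax]
        exact sub_ne_zero.2 hne⟩
      have hsub : ∀ y ∈ ((T.erase a).erase b).powersetCard m,
          a ∉ y ∧ b ∉ y ∧ y ⊆ T ∧ y.card = m := by
        intro y hy
        rw [Finset.mem_powersetCard] at hy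
        refine ⟨fun h => ?_, fun h => ?_, fun v hv => ?_, hy.2⟩
        · simpa using hy.1 h
        · simpa using hy.1 h
        · exact Finset.mem_of_mem_erase (Finset.mem_of_mem_erase (hy.1 hv))
      have hcard : ((((T.erase a).erase b).powersetCard m).filter
          fun x => G (insert a (x.erase b)) - G (insert b (x.erase a)) ≠ 0).card ≤
          ((T.powersetCard (m + 1)).filter fun x => G x ≠ 0).card := by
        -- A nonzero difference forces one of its two terms to be nonzero; `y` is recovered by
        -- forgetting `a` and `b`.
        refine Finset.card_le_card_of_injOn
          (fun x => if G (insert a x) ≠ 0 then insert a x else insert b x) ?_ ?_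
        · intro y hy
          simp only [Finset.coe_filter, Set.mem_ofPred_eq] at hy ⊢
          obtain ⟨hay, hby, hyT, hyc⟩ := hsub y hy.1
          rw [Finset.erase_eq_of_notMem hay, Finset.erase_eq_of_notMem hby] at hy
          split_ifs with h0
          · exact ⟨Finset.mem_powersetCard.2 ⟨Finset.insert_subset ha hyT,
              by rw [Finset.card_insert_of_notMem hay, hyc]⟩, h0⟩
          · refine ⟨Finset.mem_powersetCard.2 ⟨Finset.insert_subset hb hyT,
              by rw [Finset.card_insert_of_notMem hby, hyc]⟩, fun h1 => hy.2 ?_⟩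
            push Not at h0
            rw [h1, h0, sub_zero]
        · intro y hy z hz hyz
          simp only [Finset.coe_filter, Set.mem_ofPred_eq] at hy hz
          obtain ⟨hay, hby, -, -⟩ := hsub y hy.1
          obtain ⟨haz, hbz, -, -⟩ := hsub z hz.1
          ext v
          by_cases hva : v = a
          · subst hva; simp [hay, haz]
          · by_cases hvb : v = b
            · subst hvb; simp [hby, hbz]
            · have h1 := congrArg (fun s => v ∈ s) hyz
              simp only at h1
              split_ifs at h1 <;> simpa [hva, hvb] using h1
      calc (m + 1).centralBinom ≤ 4 * m.centralBinom := centralBinom_succ_le m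
        _ ≤ 4 * (4 ^ d * _) := Nat.mul_le_mul_left 4 (key.trans (Nat.mul_le_mul_left _ hcard))
        _ = _ := by ring

end SchwartzZippel

/-! ### Fourier analysis and the Nisan–Szegedy theorem on the cube -/

/-- The Walsh character of the set `S` on the cube of subsets of `ι`. -/
noncomputable def walsh {ι : Type*} [Fintype ι] [DecidableEq ι] (S : Finset ι) : Finset ι → ℝ :=
  fun x => ∏ i, if i ∈ S ∧ i ∈ x then -1 else 1

section Walsh

variable {ι : Type*} [Fintype ι] [DecidableEq ι]

lemma walsh_empty : walsh (∅ : Finset ι) = 1 := by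
  ext x
  simp [walsh]

lemma walsh_mul (S T : Finset ι) : walsh S * walsh T = walsh (symmDiff S T) := by
  ext x
  simp only [walsh, Pi.mul_apply, ← Finset.prod_mul_distrib, Finset.mem_symmDiff]
  refine Finset.prod_congr rfl fun i _ => ?_
  by_cases h1 : i ∈ S <;> by_cases h2 : i ∈ T <;> by_cases h3 : i ∈ x <;> simp [h1, h2, h3]

lemma walsh_symmDiff_singleton (S x : Finset ι) (i : ι) :
    walsh S (symmDiff x {i}) = (if i ∈ S then -1 else 1) * walsh S x := by
  have e : (if i ∈ S then -1 else 1 : ℝ) = ∏ j, if j = i then (if i ∈ S then -1 else 1) else 1 := by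
    simp
  rw [e, walsh, walsh, ← Finset.prod_mul_distrib]
  refine Finset.prod_congr rfl fun j _ => ?_
  by_cases hj : j = i
  · subst hj
    by_cases h1 : j ∈ S <;> by_cases h2 : j ∈ x <;> simp [h1, h2, Finset.mem_symmDiff]
  · simp [hj, Finset.mem_symmDiff]

/-- Flipping the coordinate `i`, as a permutation of the cube. -/
def flipEquiv (i : ι) : Equiv.Perm (Finset ι) :=
  Function.Involutive.toPerm (fun x => symmDiff x {i}) fun x => by simp

lemma sum_walsh_eq_zero {S : Finset ι} (hS : S.Nonempty) : ∑ x, walsh S x = 0 := by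
  obtain ⟨i, hi⟩ := hS
  have h1 : ∑ x, walsh S x = ∑ x, walsh S (symmDiff x {i}) :=
    (Equiv.sum_comp (flipEquiv i) (walsh S)).symm
  simp only [walsh_symmDiff_singleton, hi, if_true, ← Finset.mul_sum] at h1
  linarith

lemma sum_walsh_mul_walsh (S T : Finset ι) :
    ∑ x, walsh S x * walsh T x = if S = T then 2 ^ Fintype.card ι else 0 := by
  have h (x : Finset ι) : walsh S x * walsh T x = walsh (symmDiff S T) x :=
    congrFun (walsh_mul S T) x
  simp only [h]
  split_ifs with hST
  · subst hST
    simp [walsh_empty, Fintype.card_finset]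
  · refine sum_walsh_eq_zero (Finset.nonempty_iff_ne_empty.2 fun h0 => hST ?_)
    exact symmDiff_eq_bot.1 h0

lemma sum_sq_walsh (c : Finset ι → ℝ) :
    ∑ x, (∑ S, c S * walsh S x) ^ 2 = 2 ^ Fintype.card ι * ∑ S, c S ^ 2 := by
  have h (x : Finset ι) : (∑ S, c S * walsh S x) ^ 2 =
      ∑ S, ∑ T, c S * c T * (walsh S x * walsh T x) := by
    rw [sq, Finset.sum_mul_sum]
    exact Finset.sum_congr rfl fun S _ => Finset.sum_congr rfl fun T _ => by ring
  simp only [h]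
  rw [Finset.sum_comm, Finset.mul_sum]
  refine Finset.sum_congr rfl fun S _ => ?_
  rw [Finset.sum_comm]
  simp only [← Finset.mul_sum, sum_walsh_mul_walsh]
  simp
  ring

lemma affineFun_pow_le_span_walsh (d : ℕ) :
    affineFun ι ^ d ≤ Submodule.span ℝ (walsh '' {S : Finset ι | S.card ≤ d}) := by
  have h1 : affineFun ι ≤ Submodule.span ℝ (walsh '' {S : Finset ι | S.card ≤ 1}) := by
    have hm (S : Finset ι) (hS : S.card ≤ 1) :
        walsh S ∈ Submodule.span ℝ (walsh '' {S : Finset ι | S.card ≤ 1}) :=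
      Submodule.subset_span ⟨S, hS, rfl⟩
    refine Submodule.span_le.2 ?_
    rintro _ (rfl | ⟨v, rfl⟩)
    · rw [← walsh_empty]
      exact hm _ (by simp)
    · have e : setCoord v = (1 / 2 : ℝ) • walsh ∅ - (1 / 2 : ℝ) • walsh {v} := by
        ext x
        have : walsh {v} x = if v ∈ x then -1 else 1 := by
          rw [walsh, Finset.prod_eq_single v] <;> simp +contextual
        rw [walsh_empty]
        simp only [setCoord, Pi.sub_apply, Pi.smul_apply, Pi.one_apply, this, smul_eq_mul]
        split_ifs <;> norm_num
      rw [e]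
      exact Submodule.sub_mem _ (Submodule.smul_mem _ _ (hm _ (by simp)))
        (Submodule.smul_mem _ _ (hm _ (by simp)))
  induction d with
  | zero =>
    rw [pow_zero, Submodule.one_le, ← walsh_empty]
    exact Submodule.subset_span ⟨∅, by simp, rfl⟩
  | succ d ih =>
    rw [pow_succ]
    refine (mul_le_mul' ih h1).trans ?_
    rw [Submodule.span_mul_span]
    refine Submodule.span_mono ?_
    rintro _ ⟨_, ⟨S, hS, rfl⟩, _, ⟨T, hT, rfl⟩, rfl⟩
    refine ⟨symmDiff S T, ?_, (walsh_mul S T).symm⟩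
    have : symmDiff S T ⊆ S ∪ T := fun i hi => by
      rw [Finset.mem_symmDiff] at hi
      rw [Finset.mem_union]
      tauto
    exact (Finset.card_le_card this).trans ((Finset.card_union_le _ _).trans (add_le_add hS hT))

lemma exists_walsh_expansion {d : ℕ} {G : Finset ι → ℝ} (hG : G ∈ affineFun ι ^ d) :
    ∃ c : Finset ι → ℝ, (∀ S, d < S.card → c S = 0) ∧ ∀ x, G x = ∑ S, c S * walsh S x := by
  obtain ⟨l, hl, rfl⟩ :=
    (Finsupp.mem_span_image_iff_linearCombination ℝ).1 (affineFun_pow_le_span_walsh d hG)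
  refine ⟨l, fun S hS => ?_, fun x => ?_⟩
  · by_contra h
    exact absurd (hl (Finsupp.mem_support_iff.2 h)) (not_le.2 hS)
  · rw [Finsupp.linearCombination_apply, Finsupp.sum_fintype _ _ (by simp)]
    simp

/-- A Boolean-valued function of degree at most `d` on the cube has total influence at most `d`. -/
lemma sum_card_sensitive_le {d : ℕ} {G : Finset ι → ℝ} (hG : G ∈ affineFun ι ^ d)
    (hbool : ∀ x, G x = 0 ∨ G x = 1) :
    ∑ i, (Finset.univ.filter fun x => G x ≠ G (symmDiff x {i})).card ≤ d * 2 ^ Fintype.card ι := by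
  -- The expansion is that of `1 - 2G`, which is `±1`-valued, so Parseval gives `∑ c S ^ 2 = 1`.
  obtain ⟨c, hc, hcG⟩ := exists_walsh_expansion
    (Submodule.sub_mem _ (const_mem_affineFun_pow 1 d) (Submodule.smul_mem _ (2 : ℝ) hG))
  have hsq (x : Finset ι) : (∑ S, c S * walsh S x) ^ 2 = 1 := by
    rw [← hcG]
    rcases hbool x with h | h <;> simp [h]
    norm_num
  -- Differencing along `i` keeps exactly the characters with `i ∈ S`; summing over `i` will weight
  -- `c S ^ 2` by `S.card ≤ d`.
  have hdiff (i : ι) (x : Finset ι) : (if G x ≠ G (symmDiff x {i}) then 1 else 0 : ℝ) =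
      (∑ S, (if i ∈ S then c S else 0) * walsh S x) ^ 2 := by
    have e : ∑ S, (if i ∈ S then c S else 0) * walsh S x = G (symmDiff x {i}) - G x := by
      have h1 := hcG x
      have h2 := hcG (symmDiff x {i})
      simp only [walsh_symmDiff_singleton, Pi.sub_apply, Pi.smul_apply, smul_eq_mul] at h1 h2
      have h3 : G (symmDiff x {i}) - G x = (1 / 2) * ((1 - 2 * G x) -
        (1 - 2 * G (symmDiff x {i}))) := by ring
      rw [h3, h1, h2, ← Finset.sum_sub_distrib, Finset.mul_sum]
      refine Finset.sum_congr rfl fun S _ => ?_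
      split_ifs <;> ring
    rw [e]
    rcases hbool x with h | h <;> rcases hbool (symmDiff x {i}) with h' | h' <;> simp [h, h']
  have hpars : ∑ S, c S ^ 2 = 1 := by
    have := sum_sq_walsh c
    simp only [hsq, Finset.sum_const, Finset.card_univ, Fintype.card_finset, nsmul_eq_mul,
      mul_one] at this
    push_cast at this
    have h2 : (2 : ℝ) ^ Fintype.card ι ≠ 0 := by positivity
    exact mul_left_cancel₀ h2 (by rw [mul_one]; exact this.symm)
  have key : (∑ i, ((Finset.univ.filter fun x => G x ≠ G (symmDiff x {i})).card : ℝ)) ≤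
      d * 2 ^ Fintype.card ι := by
    calc (∑ i, ((Finset.univ.filter fun x => G x ≠ G (symmDiff x {i})).card : ℝ))
        = ∑ i, 2 ^ Fintype.card ι * ∑ S, (if i ∈ S then c S else 0) ^ 2 := by
          refine Finset.sum_congr rfl fun i _ => ?_
          rw [← sum_sq_walsh, Finset.natCast_card_filter]
          exact Finset.sum_congr rfl fun x _ => hdiff i x
      _ = 2 ^ Fintype.card ι * ∑ S, S.card * c S ^ 2 := by
          rw [← Finset.mul_sum, Finset.sum_comm]
          congr 1
          refine Finset.sum_congr rfl fun S _ => ?_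
          simp [ite_pow]
      _ ≤ 2 ^ Fintype.card ι * ∑ S, d * c S ^ 2 := by
          refine mul_le_mul_of_nonneg_left (Finset.sum_le_sum fun S _ => ?_) (by positivity)
          by_cases hS : S.card ≤ d
          · have : (S.card : ℝ) ≤ d := by exact_mod_cast hS
            gcongr
          · simp [hc S (not_le.1 hS)]
      _ = d * 2 ^ Fintype.card ι := by
          rw [← Finset.mul_sum, hpars]
          ring
  exact_mod_cast key

/-- **Nisan–Szegedy**: a Boolean-valued function of degree at most `d` on the cube depends on at
most `d * 2 ^ d` coordinates. -/
lemma card_relevant_le {d : ℕ} {G : Finset ι → ℝ} (hG : G ∈ affineFun ι ^ d)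
    (hbool : ∀ x, G x = 0 ∨ G x = 1) :
    (Finset.univ.filter fun i => ∃ x, G x ≠ G (symmDiff x {i})).card ≤ d * 2 ^ d := by
  -- Each relevant coordinate has influence at least `2 ^ -d`, while the total influence is at most
  -- `d`.
  have hrel : ∀ i ∈ Finset.univ.filter (fun i => ∃ x, G x ≠ G (symmDiff x {i})),
      2 ^ Fintype.card ι ≤
        2 ^ d * (Finset.univ.filter fun x => G x ≠ G (symmDiff x {i})).card := by
    intro i hi
    obtain ⟨x, hx⟩ := (Finset.mem_filter.1 hi).2
    have hflip (y : Finset ι) :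
        G (insert i y) - G (y.erase i) ≠ 0 ↔ G y ≠ G (symmDiff y {i}) := by
      by_cases hiy : i ∈ y
      · have : symmDiff y {i} = y.erase i := by
          ext j; by_cases hj : j = i <;> simp [Finset.mem_symmDiff, hj, hiy]
        rw [this, Finset.insert_eq_of_mem hiy, sub_ne_zero]
      · have : symmDiff y {i} = insert i y := by
          ext j; by_cases hj : j = i <;> simp [Finset.mem_symmDiff, hj, hiy]
        rw [this, Finset.erase_eq_of_notMem hiy, sub_ne_zero, ne_comm]
    have := two_pow_card_le_card_support d Finset.univ _
      (flip_difference_mem i (affineFun_pow_mono (Nat.le_succ d) hG))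
      ⟨x, Finset.subset_univ x, (hflip x).2 hx⟩
    simp only [hflip] at this
    simpa using this
  have h1 := Finset.sum_le_sum hrel
  rw [Finset.sum_const, smul_eq_mul, ← Finset.mul_sum] at h1
  have h2 := Finset.sum_le_univ_sum_of_nonneg
    (s := Finset.univ.filter (fun i => ∃ x, G x ≠ G (symmDiff x {i})))
    (f := fun i => (Finset.univ.filter fun x => G x ≠ G (symmDiff x {i})).card)
    (fun _ => Nat.zero_le _)
  refine Nat.le_of_mul_le_mul_right (c := 2 ^ Fintype.card ι) ?_ (by positivity)
  calc _ ≤ _ := h1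
    _ ≤ 2 ^ d * (d * 2 ^ Fintype.card ι) :=
      Nat.mul_le_mul_left _ (h2.trans (sum_card_sensitive_le hG hbool))
    _ = _ := by ring

end Walsh

/-! ### Cubes embedded in a slice -/

/-- The embedding of a cube into a slice that starts from `x₀` and exchanges `a i` for `b i` for
every `i ∈ y`. -/
def exchange {V ι : Type*} [DecidableEq V] (x₀ : Finset V) (a b : ι → V) (y : Finset ι) :
    Finset V :=
  (x₀ \ y.image a) ∪ y.image b

section Exchange

variable {V ι : Type*} [DecidableEq V] {x₀ : Finset V} {a b : ι → V}

lemma card_exchange (ha : Function.Injective a) (hb : Function.Injective b)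
    (hax : ∀ i, a i ∈ x₀) (hbx : ∀ i, b i ∉ x₀) (y : Finset ι) :
    (exchange x₀ a b y).card = x₀.card := by
  have h1 : y.image a ⊆ x₀ := fun v hv => by
    obtain ⟨i, -, rfl⟩ := Finset.mem_image.1 hv
    exact hax i
  have h2 : Disjoint (x₀ \ y.image a) (y.image b) := by
    rw [Finset.disjoint_left]
    intro v hv hv'
    obtain ⟨i, -, rfl⟩ := Finset.mem_image.1 hv'
    exact hbx i (Finset.mem_sdiff.1 hv).1
  have h3 := Finset.card_le_card h1
  rw [Finset.card_image_of_injective _ ha] at h3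
  rw [exchange, Finset.card_union_of_disjoint h2, Finset.card_sdiff_of_subset h1,
    Finset.card_image_of_injective _ ha, Finset.card_image_of_injective _ hb]
  omega

variable [DecidableEq ι]

/-- On the embedded cube the coordinate `a i` becomes `1 - y i`, `b i` becomes `y i`, and every
other coordinate is frozen. -/
lemma setCoord_comp_exchange_mem (ha : Function.Injective a) (hb : Function.Injective b)
    (hax : ∀ i, a i ∈ x₀) (hbx : ∀ i, b i ∉ x₀) (v : V) :
    setCoord v ∘ exchange x₀ a b ∈ affineFun ι := by
  by_cases hva : ∃ i, v = a i
  · obtain ⟨i, rfl⟩ := hva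
    have e : setCoord (a i) ∘ exchange x₀ a b = (fun _ => 1) - setCoord i := by
      ext y
      have h1 : a i ∉ y.image b := fun h => by
        obtain ⟨j, -, hj⟩ := Finset.mem_image.1 h
        exact hbx j (hj ▸ hax i)
      by_cases hi : i ∈ y <;> simp_all [setCoord, exchange, ha.eq_iff]
    rw [e]
    exact Submodule.sub_mem _ (const_mem_affineFun 1) (setCoord_mem_affineFun i)
  · by_cases hvb : ∃ i, v = b i
    · obtain ⟨i, rfl⟩ := hvb
      have e : setCoord (b i) ∘ exchange x₀ a b = setCoord i := by
        ext y
        simp [setCoord, exchange, hb.eq_iff, hbx i]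
      rw [e]
      exact setCoord_mem_affineFun i
    · have e : setCoord v ∘ exchange x₀ a b = fun _ => setCoord v x₀ := by
        ext y
        have h1 : v ∉ y.image a := fun h => by
          obtain ⟨j, -, hj⟩ := Finset.mem_image.1 h
          exact hva ⟨j, hj.symm⟩
        have h2 : v ∉ y.image b := fun h => by
          obtain ⟨j, -, hj⟩ := Finset.mem_image.1 h
          exact hvb ⟨j, hj.symm⟩
        simp only [Function.comp, setCoord, exchange, Finset.mem_union, Finset.mem_sdiff, h1, h2,
          not_false_eq_true, and_true, or_false]
      rw [e]
      exact const_mem_affineFun _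

lemma comp_exchange_mem (ha : Function.Injective a) (hb : Function.Injective b)
    (hax : ∀ i, a i ∈ x₀) (hbx : ∀ i, b i ∉ x₀) {d : ℕ} {G : Finset V → ℝ}
    (hG : G ∈ affineFun V ^ d) : (fun y => G (exchange x₀ a b y)) ∈ affineFun ι ^ d :=
  precomp_mem_affineFun_pow (setCoord_comp_exchange_mem ha hb hax hbx) hG

/-- Disjoint pairs to which a Boolean-valued function of degree at most `d` on the slice is
sensitive at a common point number at most `d * 2 ^ d`. -/
lemma card_sensitive_matching_le [Fintype ι] (ha : Function.Injective a)
    (hb : Function.Injective b) (hax : ∀ i, a i ∈ x₀) (hbx : ∀ i, b i ∉ x₀) {d : ℕ}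
    {G : Finset V → ℝ} (hG : G ∈ affineFun V ^ d)
    (hbool : ∀ x, x.card = x₀.card → G x = 0 ∨ G x = 1)
    (hsens : ∀ i, G x₀ ≠ G (insert (b i) (x₀.erase (a i)))) :
    Fintype.card ι ≤ d * 2 ^ d := by
  have h := card_relevant_le (comp_exchange_mem ha hb hax hbx hG)
    (fun y => hbool _ (card_exchange ha hb hax hbx y))
  rwa [Finset.filter_true_of_mem, Finset.card_univ] at h
  intro i _
  -- The empty set is sent to `x₀`, so sensitivity there makes every coordinate of the cube
  -- relevant.
  refine ⟨∅, ?_⟩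
  have h0 : exchange x₀ a b ∅ = x₀ := by simp [exchange]
  have h1 : exchange x₀ a b (symmDiff ∅ {i}) = insert (b i) (x₀.erase (a i)) := by
    rw [← Finset.bot_eq_empty, bot_symmDiff]
    ext v
    simp only [exchange, Finset.image_singleton, Finset.mem_union, Finset.mem_sdiff,
      Finset.mem_singleton, Finset.mem_insert, Finset.mem_erase]
    tauto
  rw [h0, h1]
  exact hsens i

end Exchange

/-! ### Exchangeability as an equivalence relation -/

section Exchangeable

variable {V : Type*} [DecidableEq V]

/-- `a` and `b` can be exchanged in every set of size `m` without changing the value of `G`. -/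
def Exchangeable (m : ℕ) (G : Finset V → ℝ) (a b : V) : Prop :=
  ∀ x : Finset V, x.card = m → G (x.map (Equiv.swap a b).toEmbedding) = G x

lemma exchangeable_refl (m : ℕ) (G : Finset V → ℝ) (a : V) : Exchangeable m G a a := by
  intro x _
  rw [Equiv.swap_self, Equiv.refl_toEmbedding, Finset.map_refl]

lemma Exchangeable.symm {m : ℕ} {G : Finset V → ℝ} {a b : V} (h : Exchangeable m G a b) :
    Exchangeable m G b a := by
  intro x hx
  rw [Equiv.swap_comm]
  exact h x hx

/-- For distinct points, `(a c) = (b c)(a b)(b c)`, and each factor preserves cardinality. -/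
lemma Exchangeable.trans {m : ℕ} {G : Finset V → ℝ} {a b c : V} (hab : Exchangeable m G a b)
    (hbc : Exchangeable m G b c) : Exchangeable m G a c := by
  by_cases h1 : a = b
  · rwa [h1]
  by_cases h2 : a = c
  · rw [h2]
    exact exchangeable_refl m G c
  intro x hx
  have e : x.map (Equiv.swap a c).toEmbedding = ((x.map (Equiv.swap b c).toEmbedding).map
      (Equiv.swap a b).toEmbedding).map (Equiv.swap b c).toEmbedding := by
    rw [Equiv.swap_comm a c, ← Equiv.swap_mul_swap_mul_swap h1 h2, Finset.map_map, Finset.map_map]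
    rfl
  rw [e, hbc _ (by simp [hx]), hab _ (by simp [hx]), hbc _ hx]

lemma map_swap_eq_insert_erase {a b : V} {x : Finset V} (ha : a ∈ x) (hb : b ∉ x) :
    x.map (Equiv.swap a b).toEmbedding = insert b (x.erase a) := by
  ext v
  have hab : a ≠ b := fun h => hb (h ▸ ha)
  have : v ∈ x.map (Equiv.swap a b).toEmbedding ↔ Equiv.swap a b v ∈ x := by
    rw [Finset.mem_map_equiv, Equiv.symm_swap]
  rw [this]
  by_cases h1 : v = a
  · subst h1
    simp [hb, hab]
  · by_cases h2 : v = b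
    · subst h2
      simp [ha]
    · simp [Equiv.swap_apply_of_ne_of_ne h1 h2, h1, h2]

/-- A set on which the swap matters contains exactly one of `a` and `b`; if it is `b`, the swapped
set serves. -/
lemma exists_of_not_exchangeable {m : ℕ} {G : Finset V → ℝ} {a b : V}
    (h : ¬ Exchangeable m G a b) :
    ∃ x : Finset V, x.card = m ∧ a ∈ x ∧ b ∉ x ∧ G x ≠ G (insert b (x.erase a)) := by
  simp only [Exchangeable, not_forall] at h
  obtain ⟨x, hx, hne⟩ := h
  have hmem (v : V) : v ∈ x.map (Equiv.swap a b).toEmbedding ↔ Equiv.swap a b v ∈ x := by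
    rw [Finset.mem_map_equiv, Equiv.symm_swap]
  have hself : ¬ (a ∈ x ↔ b ∈ x) := by
    intro hiff
    refine hne (congrArg G ?_)
    ext v
    rw [hmem]
    by_cases h1 : v = a
    · subst h1; simp [hiff]
    · by_cases h2 : v = b
      · subst h2; simp [hiff]
      · rw [Equiv.swap_apply_of_ne_of_ne h1 h2]
  by_cases ha : a ∈ x
  · have hb : b ∉ x := fun hb => hself (by simp [ha, hb])
    exact ⟨x, hx, ha, hb, fun h => hne (by rw [map_swap_eq_insert_erase ha hb, h])⟩
  · have hb : b ∈ x := by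
      by_contra hb
      exact hself (by simp [ha, hb])
    have e := map_swap_eq_insert_erase hb ha
    rw [Equiv.swap_comm] at e
    refine ⟨x.map (Equiv.swap a b).toEmbedding, by simp [hx], ?_, ?_, fun h => hne ?_⟩
    · rw [hmem]; simpa using hb
    · rw [hmem]; simpa using ha
    · rw [h, e]
      congr 1
      ext v
      by_cases h1 : v = a
      · subst h1
        by_cases h2 : v = b <;> simp_all
      · by_cases h2 : v = b
        · subst h2; simp [hb]
        · simp [h1, h2]

end Exchangeable

/-! ### Double counting of sensitive pairs -/

section Sensitivity

variable {V : Type*} [Fintype V] [DecidableEq V]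

/-- The pairs whose exchange at the point `x` changes the value of `G`. -/
noncomputable def sensitivePairs (G : Finset V → ℝ) (x : Finset V) : Finset (V × V) :=
  (x ×ˢ xᶜ).filter fun p => G x ≠ G (insert p.2 (x.erase p.1))

/-- The sensitive pairs are the edges of a bipartite graph between `x` and `xᶜ`. The endpoints of a
maximum matching `M` cover all edges, each endpoint meets at most `m` of them, and `M` has at most
`d * 2 ^ d` edges. -/
lemma card_sensitivePairs_le {d m : ℕ} (hV : Fintype.card V = 2 * m) {G : Finset V → ℝ}
    (hG : G ∈ affineFun V ^ d) (hbool : ∀ x, x.card = m → G x = 0 ∨ G x = 1) {x : Finset V}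
    (hx : x.card = m) : (sensitivePairs G x).card ≤ 2 * (d * 2 ^ d) * m := by
  classical
  obtain ⟨M, hM, hmax⟩ := Finset.exists_max_image
    ((sensitivePairs G x).powerset.filter fun M : Finset (V × V) => Set.InjOn Prod.fst (M : Set (V × V)) ∧
      Set.InjOn Prod.snd (M : Set (V × V))) Finset.card ⟨∅, by simp⟩
  rw [Finset.mem_filter, Finset.mem_powerset] at hM
  obtain ⟨hMs, hinj1, hinj2⟩ := hM
  have hmem : ∀ p ∈ sensitivePairs G x,
      p.1 ∈ x ∧ p.2 ∉ x ∧ G x ≠ G (insert p.2 (x.erase p.1)) := by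
    intro p hp
    simpa [sensitivePairs, and_assoc] using hp
  have hMcard : M.card ≤ d * 2 ^ d := by
    have := card_sensitive_matching_le (ι := {p // p ∈ M}) (x₀ := x) (a := fun p => p.1.1)
      (b := fun p => p.1.2) (fun p q h => Subtype.ext (hinj1 p.2 q.2 h))
      (fun p q h => Subtype.ext (hinj2 p.2 q.2 h)) (fun p => (hmem _ (hMs p.2)).1)
      (fun p => (hmem _ (hMs p.2)).2.1) hG (fun y hy => hbool y (hy.trans hx))
      (fun p => (hmem _ (hMs p.2)).2.2)
    simpa using this
  have hxc : xᶜ.card = m := by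
    rw [Finset.card_compl, hV, hx]
    omega
  have hcover : sensitivePairs G x ⊆ (M.image Prod.fst) ×ˢ xᶜ ∪ x ×ˢ (M.image Prod.snd) := by
    intro p hp
    obtain ⟨h1, h2, -⟩ := hmem p hp
    rw [Finset.mem_union, Finset.mem_product, Finset.mem_product]
    by_contra hcon
    simp only [Finset.mem_compl, h1, h2, not_false_eq_true, and_true, true_and, not_or] at hcon
    have hpM : p ∉ M := fun h => hcon.1 (Finset.mem_image_of_mem _ h)
    -- A pair missed by both endpoint sets could be added to the matching.
    have := hmax (insert p M) (by
      rw [Finset.mem_filter, Finset.mem_powerset, Finset.coe_insert,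
        Set.injOn_insert (by simpa using hpM), Set.injOn_insert (by simpa using hpM)]
      refine ⟨Finset.insert_subset hp hMs, ⟨hinj1, fun h => hcon.1 ?_⟩,
        ⟨hinj2, fun h => hcon.2 ?_⟩⟩ <;> simpa using h)
    rw [Finset.card_insert_of_notMem hpM] at this
    omega
  calc (sensitivePairs G x).card ≤ _ := Finset.card_le_card hcover
    _ ≤ (M.image Prod.fst).card * m + m * (M.image Prod.snd).card := by
      refine (Finset.card_union_le _ _).trans ?_
      rw [Finset.card_product, Finset.card_product, hxc, hx]
    _ ≤ (d * 2 ^ d) * m + m * (d * 2 ^ d) := by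
      gcongr
      · exact Finset.card_image_le.trans hMcard
      · exact Finset.card_image_le.trans hMcard
    _ = _ := by ring

/-- Schwartz–Zippel for the transposition difference on the slice without `a` and `b` costs `4 ^ d`;
returning to the slice of `V` costs the last 4. -/
lemma centralBinom_le_of_not_exchangeable {d m : ℕ} (hV : Fintype.card V = 2 * m)
    {G : Finset V → ℝ} (hG : G ∈ affineFun V ^ d) {a b : V} (h : ¬ Exchangeable m G a b) :
    m.centralBinom ≤ 4 ^ (d + 1) * ((Finset.univ.powersetCard m).filter
      fun x => (a, b) ∈ sensitivePairs G x).card := by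
  obtain ⟨x, hx, hax, hbx, hne⟩ := exists_of_not_exchangeable h
  have hab : a ≠ b := fun h => hbx (h ▸ hax)
  obtain ⟨m, rfl⟩ : ∃ k, m = k + 1 := ⟨m - 1, by
    have := Finset.card_pos.2 ⟨a, hax⟩
    omega⟩
  have hcT : ((Finset.univ.erase a).erase b).card = 2 * m := by
    rw [Finset.card_erase_of_mem (by simpa using hab.symm),
      Finset.card_erase_of_mem (Finset.mem_univ _), Finset.card_univ, hV]
    omega
  have hxb : (x.erase a).erase b = x.erase a :=
    Finset.erase_eq_of_notMem fun h => hbx (Finset.mem_of_mem_erase h)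
  have key := centralBinom_le_card_support d m _ hcT _
    (swap_difference_mem hab (affineFun_pow_mono (Nat.le_succ d) hG)) ⟨x.erase a, by
      rw [Finset.mem_powersetCard, Finset.card_erase_of_mem hax, hx]
      refine ⟨fun v hv => ?_, rfl⟩
      have h1 := Finset.mem_erase.1 hv
      simp only [Finset.mem_erase, Finset.mem_univ, and_true]
      exact ⟨fun h => hbx (h ▸ h1.2), h1.1⟩, by
      rw [hxb, Finset.erase_idem, Finset.insert_erase hax]
      exact sub_ne_zero.2 hne⟩
  have hcard : ((((Finset.univ.erase a).erase b).powersetCard m).filter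
      fun x => G (insert a (x.erase b)) - G (insert b (x.erase a)) ≠ 0).card ≤
      ((Finset.univ.powersetCard (m + 1)).filter fun x => (a, b) ∈ sensitivePairs G x).card := by
    have hsub : ∀ y ∈ ((Finset.univ.erase a).erase b).powersetCard m,
        a ∉ y ∧ b ∉ y ∧ y.card = m := by
      intro y hy
      rw [Finset.mem_powersetCard] at hy
      refine ⟨fun h => ?_, fun h => ?_, hy.2⟩
      · simpa using hy.1 h
      · simpa using hy.1 h
    refine Finset.card_le_card_of_injOn (fun y => insert a y) ?_ ?_
    · intro y hy
      simp only [Finset.coe_filter, Set.mem_ofPred_eq] at hy ⊢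
      obtain ⟨hay, hby, hyc⟩ := hsub y hy.1
      rw [Finset.erase_eq_of_notMem hay, Finset.erase_eq_of_notMem hby] at hy
      refine ⟨Finset.mem_powersetCard.2 ⟨Finset.subset_univ _,
        by rw [Finset.card_insert_of_notMem hay, hyc]⟩, ?_⟩
      simp only [sensitivePairs, Finset.mem_filter, Finset.mem_product, Finset.mem_compl,
        Finset.mem_insert, true_or, true_and, not_or, Finset.erase_insert hay]
      exact ⟨⟨hab.symm, hby⟩, sub_ne_zero.1 hy.2⟩
    · intro y hy z hz hyz
      simp only [Finset.coe_filter, Set.mem_ofPred_eq] at hy hz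
      have h1 := congrArg (fun s => s.erase a) hyz
      simpa [Finset.erase_insert (hsub y hy.1).1, Finset.erase_insert (hsub z hz.1).1] using h1
  calc (m + 1).centralBinom ≤ 4 * m.centralBinom := centralBinom_succ_le m
    _ ≤ 4 * (4 ^ d * _) := Nat.mul_le_mul_left 4 (key.trans (Nat.mul_le_mul_left _ hcard))
    _ = _ := by ring

-- Incidences between pairs and points are counted twice: each non-exchangeable pair is sensitive at
-- many points, each point has few sensitive pairs.
open Classical in
lemma card_not_exchangeable_le {d m : ℕ} (hV : Fintype.card V = 2 * m) {G : Finset V → ℝ}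
    (hG : G ∈ affineFun V ^ d) (hbool : ∀ x, x.card = m → G x = 0 ∨ G x = 1) :
    (Finset.univ.filter fun p : V × V => ¬ Exchangeable m G p.1 p.2).card ≤
      4 ^ (d + 1) * (2 * (d * 2 ^ d) * m) := by
  set R := Finset.univ.filter fun p : V × V => ¬ Exchangeable m G p.1 p.2
  set X := (Finset.univ : Finset V).powersetCard m with hX
  have hXc : X.card = m.centralBinom := by
    rw [hX, Finset.card_powersetCard, Finset.card_univ, hV, Nat.centralBinom_eq_two_mul_choose]
  refine Nat.le_of_mul_le_mul_right (c := m.centralBinom) ?_ (Nat.centralBinom_pos m)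
  calc R.card * m.centralBinom = ∑ p ∈ R, m.centralBinom := by simp
    _ ≤ ∑ p ∈ R, 4 ^ (d + 1) * (X.filter fun x => p ∈ sensitivePairs G x).card :=
      Finset.sum_le_sum fun p hp =>
        centralBinom_le_of_not_exchangeable hV hG (Finset.mem_filter.1 hp).2
    _ ≤ ∑ p, 4 ^ (d + 1) * (X.filter fun x => p ∈ sensitivePairs G x).card :=
      Finset.sum_le_univ_sum_of_nonneg fun _ => Nat.zero_le _
    _ = 4 ^ (d + 1) * ∑ x ∈ X, (sensitivePairs G x).card := by
      rw [← Finset.mul_sum]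
      congr 1
      simp only [Finset.card_filter]
      rw [Finset.sum_comm]
      simp
    _ ≤ 4 ^ (d + 1) * ∑ x ∈ X, 2 * (d * 2 ^ d) * m := by
      gcongr with x hx
      exact card_sensitivePairs_le hV hG hbool (Finset.mem_powersetCard.1 hx).2
    _ = _ := by
      rw [Finset.sum_const, hXc, smul_eq_mul]
      ring

/-- If few pairs fail to be exchangeable, then the function depends on at most half of the
coordinates. -/
lemma exists_half_junta {d m : ℕ} (hV : Fintype.card V = 2 * m) {G : Finset V → ℝ}
    (hG : G ∈ affineFun V ^ d) (hbool : ∀ x, x.card = m → G x = 0 ∨ G x = 1)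
    (hm : 4 ^ (d + 1) * (d * 2 ^ d) < m) :
    ∃ S : Finset V, S.card ≤ m ∧ ∀ x y : Finset V, x.card = m → y.card = m →
      (∀ i ∈ S, i ∈ x ↔ i ∈ y) → G x = G y := by
  classical
  -- Averaging: otherwise there are at least `2 * m * m` non-exchangeable pairs, against `hm`.
  obtain ⟨a, ha⟩ : ∃ a, (Finset.univ.filter fun b => ¬ Exchangeable m G a b).card ≤ m := by
    by_contra! hcon
    have h1 := card_not_exchangeable_le hV hG hbool
    have h2 : (Finset.univ.filter fun p : V × V => ¬ Exchangeable m G p.1 p.2).card =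
        ∑ a, (Finset.univ.filter fun b => ¬ Exchangeable m G a b).card := by
      simp only [Finset.card_filter, ← Finset.univ_product_univ, Finset.sum_product]
    have h3 : Fintype.card V * m ≤
        ∑ a, (Finset.univ.filter fun b => ¬ Exchangeable m G a b).card := by
      rw [← smul_eq_mul, ← Finset.card_univ, ← Finset.sum_const]
      exact Finset.sum_le_sum fun a _ => (hcon a).le
    rw [hV] at h3
    have h4 := h3.trans (h2 ▸ h1)
    have h5 : 4 ^ (d + 1) * (2 * (d * 2 ^ d) * m) = 2 * (4 ^ (d + 1) * (d * 2 ^ d)) * m := by ring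
    rw [h5] at h4
    have := Nat.le_of_mul_le_mul_right h4 (by omega)
    omega
  -- `S` is the complement of the class of `a`, so `x` and `y` differ only inside that class, where
  -- any two elements are exchangeable through `a`.
  refine ⟨_, ha, fun x y hx hy hxy => ?_⟩
  have hA : ∀ v, ¬ (v ∈ x ↔ v ∈ y) → v ∈ Finset.univ.filter fun b => Exchangeable m G a b := by
    intro v hv
    by_contra hv'
    exact hv (hxy v (by simpa using hv'))
  refine eq_of_exchange_invariant ?_ x y hx hy (fun v hv => hA v ?_) (fun v hv => hA v ?_)
  · intro p hp q hq z hz hpz hqz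
    rw [← map_swap_eq_insert_erase hpz hqz]
    exact ((Finset.mem_filter.1 hp).2.symm.trans (Finset.mem_filter.1 hq).2 z hz).symm
  · rw [Finset.mem_sdiff] at hv; tauto
  · rw [Finset.mem_sdiff] at hv; tauto

end Sensitivity

/-! ### From half of the coordinates to `d * 2 ^ d` -/

lemma eq_of_agree_on_relevant {ι : Type*} [DecidableEq ι] {F : Finset ι → ℝ} {y z : Finset ι}
    (h : ∀ i, (∃ x, F x ≠ F (symmDiff x {i})) → (i ∈ y ↔ i ∈ z)) : F y = F z := by
  have key : ∀ D : Finset ι, (∀ i ∈ D, ∀ x, F x = F (symmDiff x {i})) →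
      F (symmDiff y D) = F y := by
    intro D
    induction D using Finset.induction_on with
    | empty => intro _; rw [← Finset.bot_eq_empty, symmDiff_bot]
    | insert a s ha ih =>
      intro hD
      have e : symmDiff y (insert a s) = symmDiff (symmDiff y s) {a} := by
        ext v
        by_cases hv : v = a
        · subst hv; simp [Finset.mem_symmDiff, ha]
        · simp [Finset.mem_symmDiff, hv]
      rw [e, ← hD a (Finset.mem_insert_self _ _)]
      exact ih fun i hi => hD i (Finset.mem_insert_of_mem hi)
  have := key (symmDiff y z) fun i hi x => by
    by_contra hne
    have := h i ⟨x, hne⟩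
    rw [Finset.mem_symmDiff] at hi
    tauto
  rw [← this, symmDiff_symmDiff_cancel_left]

/-- A Boolean-valued function of degree at most `d` on the middle slice that depends on at most
half of the coordinates depends on at most `d * 2 ^ d` of them. -/
lemma exists_junta_of_half_junta {V : Type*} [Fintype V] [DecidableEq V] {d m : ℕ}
    (hV : Fintype.card V = 2 * m) {G : Finset V → ℝ} (hG : G ∈ affineFun V ^ d)
    (hbool : ∀ x, x.card = m → G x = 0 ∨ G x = 1) {S : Finset V} (hS : S.card ≤ m)
    (hdep : ∀ x y : Finset V, x.card = m → y.card = m → (∀ i ∈ S, i ∈ x ↔ i ∈ y) → G x = G y) :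
    ∃ J : Finset V, J.card ≤ d * 2 ^ d ∧ ∀ x y : Finset V, x.card = m → y.card = m →
      (∀ i ∈ J, i ∈ x ↔ i ∈ y) → G x = G y := by
  classical
  have hSc : Sᶜ.card = 2 * m - S.card := by rw [Finset.card_compl, hV]
  -- `B` supplies the exchange partners of `S`, and `Z` pads `S` to a base point of size `m`
  -- avoiding `B`; `S.card ≤ m` leaves room for both.
  obtain ⟨B, hBS, hBc⟩ := Finset.exists_subset_card_eq (s := Sᶜ) (n := S.card) (by omega)
  obtain ⟨Z, hZ, hZc⟩ := Finset.exists_subset_card_eq (s := Sᶜ \ B) (n := m - S.card) (by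
    rw [Finset.card_sdiff_of_subset hBS]
    omega)
  let e : S ≃ B := Finset.equivOfCardEq hBc.symm
  set a : S → V := Subtype.val with ha'
  set b : S → V := fun i => (e i).1 with hb'
  have ha : Function.Injective a := Subtype.val_injective
  have hb : Function.Injective b := Subtype.val_injective.comp e.injective
  have hbS (i : S) : b i ∉ S := Finset.mem_compl.1 (hBS (e i).2)
  have hax (i : S) : a i ∈ S ∪ Z := Finset.mem_union_left _ i.2
  have hbx (i : S) : b i ∉ S ∪ Z := fun h => by
    rcases Finset.mem_union.1 h with h | h
    · exact hbS i h
    · exact (Finset.mem_sdiff.1 (hZ h)).2 (e i).2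
  have hdisj : Disjoint S Z := by
    rw [Finset.disjoint_right]
    exact fun v hv => Finset.mem_compl.1 (Finset.mem_sdiff.1 (hZ hv)).1
  have hcard (y : Finset S) : (exchange (S ∪ Z) a b y).card = m := by
    rw [card_exchange ha hb hax hbx, Finset.card_union_of_disjoint hdisj, hZc]
    omega
  have hrel := card_relevant_le (comp_exchange_mem ha hb hax hbx hG) (fun y => hbool _ (hcard y))
  set F : Finset S → ℝ := fun y => G (exchange (S ∪ Z) a b y)
  -- The cube point `S \ x` is mapped to a set with the same trace on `S` as `x`, so `F` determines
  -- `G` on the entire slice.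
  have hF (x : Finset V) (hx : x.card = m) :
      G x = F (Finset.univ.filter fun i : S => i.1 ∉ x) := by
    refine hdep _ _ hx (hcard _) fun v hv => ?_
    have h2 : v ∉ (Finset.univ.filter fun i : S => i.1 ∉ x).image b := fun h => by
      obtain ⟨i, -, hi⟩ := Finset.mem_image.1 h
      exact hbS i (hi ▸ hv)
    simp only [exchange, Finset.mem_union, Finset.mem_sdiff, h2, hv, true_or, true_and, or_false]
    simp [ha', hv]
  refine ⟨(Finset.univ.filter fun i => ∃ x, F x ≠ F (symmDiff x {i})).image a,
    Finset.card_image_le.trans hrel, fun x y hx hy hxy => ?_⟩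
  rw [hF x hx, hF y hy]
  refine eq_of_agree_on_relevant fun i hi => ?_
  have := hxy i.1 (Finset.mem_image_of_mem a (by simpa using hi))
  simp [this]

/-! ### Choice of constants and conclusion -/

/-- The constant `1 / 10` gives `2m ≥ 2 ^ (10 * d) ≥ 2 ^ (4 * d + 3)` for `d ≥ 1`, and `d < 2 ^ d`
puts the left side below `2 ^ (4 * d + 2)`. -/
lemma lt_half_of_le_log {d m : ℕ} (hd : 0 < d) (h : (d : ℝ) ≤ 1 / 10 * Real.log ((m + m : ℕ) : ℝ)) :
    4 ^ (d + 1) * (d * 2 ^ d) < m := by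
  have hm : 0 < m := by
    rcases Nat.eq_zero_or_pos m with rfl | hm
    · have : (0 : ℝ) < d := by exact_mod_cast hd
      simp at h
      omega
    · exact hm
  have h1 : (2 : ℝ) ^ (10 * d) ≤ ((m + m : ℕ) : ℝ) := by
    have h2 : Real.exp (10 * d) ≤ ((m + m : ℕ) : ℝ) := by
      rw [← Real.le_log_iff_exp_le (by exact_mod_cast (by omega : 0 < m + m))]
      linarith
    refine le_trans ?_ h2
    have h3 : (2 : ℝ) ≤ Real.exp 1 := by
      have := Real.add_one_le_exp 1
      linarith
    calc (2 : ℝ) ^ (10 * d) ≤ Real.exp 1 ^ (10 * d) := by gcongr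
      _ = Real.exp (10 * d) := by
        rw [← Real.exp_nat_mul]
        push_cast
        ring_nf
  have h2 : 2 ^ (10 * d) ≤ m + m := by exact_mod_cast h1
  have h3 : 2 ^ (4 * d + 3) ≤ 2 ^ (10 * d) := Nat.pow_le_pow_right (by norm_num) (by omega)
  have h4 : 4 ^ (d + 1) * (d * 2 ^ d) < 4 ^ (d + 1) * (2 ^ d * 2 ^ d) := by
    gcongr
    exact Nat.lt_two_pow_self
  have h5 : 4 ^ (d + 1) * (2 ^ d * 2 ^ d) = 2 ^ (4 * d + 2) := by
    rw [show (4 : ℕ) = 2 ^ 2 by norm_num, ← pow_mul, ← pow_add, ← pow_add]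
    congr 1
    ring
  have h6 : 2 ^ (4 * d + 3) = 2 * 2 ^ (4 * d + 2) := by ring
  omega

theorem mainTheorem7 :
    ∃ C : ℝ, 0 < C ∧ ∃ K : ℕ, ∀ d n : ℕ, Even n → (d : ℝ) ≤ C * Real.log (n : ℝ) →
      ∀ f : BooleanSlice n (n / 2) → ℝ, IsBooleanValued f → IsSliceDegree d f →
        IsSliceJunta (K * d * 2 ^ d) f := by
  refine ⟨1 / 10, by norm_num, 1, ?_⟩
  rintro d _ ⟨m, rfl⟩ hd f hbool ⟨P, -, hdeg, hP⟩
  have hm : (m + m) / 2 = m := by omega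
  set G : Finset (Fin (m + m)) → ℝ := fun x => MvPolynomial.eval (fun v => setCoord v x) P with hGdef
  have hG : G ∈ affineFun (Fin (m + m)) ^ d := eval_setCoord_mem_affineFun_pow P hdeg
  have hfG (x : BooleanSlice (m + m) ((m + m) / 2)) :
      f x = G (Finset.univ.filter fun i => x.1 i = true) := by
    rw [hP, hGdef]
    congr 2
    ext v
    simp [BooleanSlice.toReal, setCoord]
  have hGbool (x : Finset (Fin (m + m))) (hx : x.card = m) : G x = 0 ∨ G x = 1 := by
    have := hbool ⟨fun i => decide (i ∈ x), by simp [hx, hm]⟩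
    simpa [hfG] using this
  obtain ⟨J, hJ, hJG⟩ : ∃ J : Finset (Fin (m + m)), J.card ≤ d * 2 ^ d ∧
      ∀ x y : Finset (Fin (m + m)), x.card = m → y.card = m →
        (∀ i ∈ J, i ∈ x ↔ i ∈ y) → G x = G y := by
    -- For `d = 0` the strict bound fails at `m = 0`, but `G` is constant.
    rcases Nat.eq_zero_or_pos d with rfl | hd0
    · obtain ⟨c, hc⟩ := exists_const_of_mem_affineFun_pow_zero hG
      exact ⟨∅, by simp, fun x y _ _ _ => by rw [hc, hc]⟩
    · have hV : Fintype.card (Fin (m + m)) = 2 * m := by rw [Fintype.card_fin]; omega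
      obtain ⟨S, hS, hdep⟩ := exists_half_junta hV hG hGbool (lt_half_of_le_log hd0 hd)
      exact exists_junta_of_half_junta hV hG hGbool hS hdep
  refine ⟨J, by rwa [one_mul], fun x y hxy => ?_⟩
  rw [hfG, hfG]
  refine hJG _ _ (x.2.trans hm) (y.2.trans hm) fun i hi => ?_
  simp [hxy i hi]
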